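/- For a positive integer $N$ and a set $A \subseteq \mathbb{Z}/N\mathbb{Z}$, let $G_A$ be the Cayley sum graph on the vertex set $\mathbb{Z}/N\mathbb{Z}$ in which two distinct vertices $i$ and $j$ are joined by an edge if and only if $i + j \in A$, and let $\omega(G_A)$ be its clique number, that is, the largest number of vertices in a complete subgraph of $G_A$. If $A$ is chosen uniformly at random among all $2^N$ subsets of $\mathbb{Z}/N\mathbb{Z}$, then $$\lim_{N \to \infty} \mathbb{P}\bigl(\omega(G_A) \leq 160 \log_2 N\bigr) = 1,$$ where $N$ runs over all positive integers. -/

import Mathlib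

open Filter Topology

/-- The Cayley sum graph `G_A` of a subset `A` of an abelian group: distinct vertices `i` and `j`
are joined if and only if `i + j ∈ A`. -/
def cayleySumGraph {Γ : Type*} [AddCommGroup Γ] (A : Set Γ) : SimpleGraph Γ where
  Adj i j := i ≠ j ∧ i + j ∈ A
  symm := ⟨fun i j h => ⟨h.1.symm, by rw [add_comm]; exact h.2⟩⟩
  loopless := ⟨fun _ h => h.1 rfl⟩

/-- The probability that the random Cayley sum graph `G_A` on the finite abelian group `Γ` has the
property `E`, where `A` is uniformly distributed over all subsets of `Γ`: the proportion of the
subsets `A` of `Γ` such that `G_A` has the property `E`. -/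
noncomputable def cayleySumProb (Γ : Type*) [AddCommGroup Γ] [Finite Γ]
    (E : SimpleGraph Γ → Prop) : ℝ :=
  (Nat.card {A : Set Γ // E (cayleySumGraph A)} : ℝ) / (Nat.card (Set Γ) : ℝ)

/-! A clique of size `k` is a `k`-set `X` whose sums of distinct elements all lie in `A`. For fixed
`X` this has probability `2 ^ (-|distinctSums X|)`, and `|distinctSums X| ≥ |X + X| - k`. With `k`
just above `160 log₂ N`, a union bound over all of the roughly `N ^ k` sets fails when `m = |X + X|`
is only a multiple of `k`, so sets with small sumset must be shown to be few.

By Ruzsa covering, `X ⊆ Y + Y - Y` for some `Y ⊆ X` with at most `2√m + 2` elements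
(`exists_small_subset_add_sub`). A weighted Freiman lemma (`finrank_span_image_mul_card_le`) shows
that an enumeration of `Y` has at most `2m/k` degrees of freedom modulo its additive relations.
Hence there are only `N ^ (2m/k) * exp (O(√m log m))` choices for `Y`
(`card_filter_additiveRank_le`).

If `m ≥ 32k`, Plünnecke's inequality gives `|Y + Y - Y| ≤ m³/k²`, and choosing `X` inside it costs
at most `2 ^ (17m/32)`, which `2 ^ (-(m - k))` beats. If `m < 32k` that choice is too expensive.
Instead `Y` is enlarged, still to `O(√k)` elements, until its own distinct sums number at least
`3k/4` (`exists_small_subsets_card_add_ge`). The union bound then runs over `Y` alone, whose freedom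
is at most `N ^ 64`, about `2 ^ (2k/5)`. -/

open scoped Pointwise

/-! ### A weighted Freiman lemma -/

open Module Submodule in
/-- In an ordered vector space over `ℚ`, every finite set `P` with maximum `p` lies in the span of
those `q ∈ P` for which `p + q` is not a sum of two elements of `P` other than `p`. -/
theorem subset_span_filter_add_max {W : Type*} [AddCommGroup W] [Module ℚ W] [LinearOrder W]
    [IsOrderedAddMonoid W] (P : Finset W) (p : W) (hp : p ∈ P) (hmax : ∀ q ∈ P, q ≤ p)
    (Q : Finset W)
    (hQ : ∀ q ∈ P, (∀ a ∈ P, ∀ b ∈ P, a ≠ p → b ≠ p → p + q ≠ a + b) → q ∈ Q) :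
    (P : Set W) ⊆ span ℚ (Q : Set W) := by
  classical
  have hpQ : p ∈ Q := by
    refine hQ p hp fun a ha b hb hap hbp h => ?_
    exact (add_lt_add ((hmax a ha).lt_of_ne hap) ((hmax b hb).lt_of_ne hbp)).ne h.symm
  by_contra hcon
  have hne : (P.filter fun q => q ∉ span ℚ (Q : Set W)).Nonempty := by
    obtain ⟨q, hq, hq'⟩ := Set.not_subset.1 hcon
    exact ⟨q, Finset.mem_filter.2 ⟨hq, hq'⟩⟩
  -- Take the largest `q` outside the span. In `p + q = a + b` both `a` and `b` are below `p`, so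
  -- both exceed `q` and lie in the span, which puts `q` there too.
  obtain ⟨q, hq, hqmax⟩ := Finset.exists_max_image _ id hne
  rw [Finset.mem_filter] at hq
  have hqQ : q ∉ Q := fun h => hq.2 (subset_span h)
  have : ∃ a ∈ P, ∃ b ∈ P, a ≠ p ∧ b ≠ p ∧ p + q = a + b := by
    by_contra! h
    exact hqQ (hQ q hq.1 fun a ha b hb hap hbp => h a ha b hb hap hbp)
  obtain ⟨a, ha, b, hb, hap, hbp, h⟩ := this
  have key : ∀ c ∈ P, ∀ d ∈ P, d ≠ p → p + q = c + d → c ∈ span ℚ (Q : Set W) := by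
    intro c hc d hd hdp hcd
    by_contra hcs
    have h1 : c ≤ q := hqmax c (Finset.mem_filter.2 ⟨hc, hcs⟩)
    have h2 : d < p := (hmax d hd).lt_of_ne hdp
    have h3 : c + d < p + q := by
      rw [add_comm p q]; exact add_lt_add_of_le_of_lt h1 h2
    exact h3.ne hcd.symm
  have h1 := key a ha b hb hbp h
  have h2 := key b hb a ha hap (by rw [h, add_comm])
  have : q = a + b - p := by rw [← h]; abel
  exact hq.2 (this ▸ sub_mem (add_mem h1 h2) (subset_span hpQ))

open Module Submodule in
/-- A weighted form of Freiman's lemma: if `φ` is a Freiman homomorphism from the finite set `X` to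
an ordered vector space over `ℚ`, then `|X + X|` is at least half of the dimension of the span of
`φ(X)` times `|X|`. -/
theorem finrank_span_image_mul_card_le {Γ W : Type*} [AddCommGroup Γ] [DecidableEq Γ]
    [AddCommGroup W] [Module ℚ W] [LinearOrder W] [IsOrderedAddMonoid W] (φ : Γ → W)
    (X : Finset Γ)
    (hφ : ∀ a ∈ X, ∀ b ∈ X, ∀ c ∈ X, ∀ d ∈ X, a + b = c + d → φ a + φ b = φ c + φ d) :
    finrank ℚ (span ℚ (φ '' X)) * X.card ≤ 2 * (X + X).card := by
  rw [← Finset.coe_image]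
  induction hn : X.card using Nat.strong_induction_on generalizing X with
  | _ n ih =>
  subst hn
  rcases X.eq_empty_or_nonempty with rfl | hX
  · simp
  obtain ⟨x₀, hx₀, hmax⟩ := Finset.exists_max_image X φ hX
  set p := φ x₀ with hp
  set F := X.filter fun x => φ x = p with hF
  set X' := X.filter fun x => ¬ φ x = p with hX'
  have hsplit : F.card + X'.card = X.card := Finset.card_filter_add_card_filter_not _
  have hF0 : 0 < F.card := Finset.card_pos.2 ⟨x₀, by simp [hF, hx₀, hp]⟩
  have hX'X : X' ⊆ X := Finset.filter_subset _ _
  have hFX : F ⊆ X := Finset.filter_subset _ _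
  have hIH := ih X'.card (by omega) X' (fun a ha b hb c hc d hd =>
    hφ a (hX'X ha) b (hX'X hb) c (hX'X hc) d (hX'X hd)) rfl
  set D := finrank ℚ (span ℚ (X.image φ : Set W)) with hD
  set D' := finrank ℚ (span ℚ (X'.image φ : Set W)) with hD'
  have hsub : X' + X' ⊆ X + X := Finset.add_subset_add hX'X hX'X
  set G := (X.image φ).filter fun q =>
    ∀ a ∈ X.image φ, ∀ b ∈ X.image φ, a ≠ p → b ≠ p → p + q ≠ a + b with hG
  have hspan := subset_span_filter_add_max (X.image φ) p (Finset.mem_image_of_mem _ hx₀)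
    (by simpa using hmax) G (fun q hq h => Finset.mem_filter.2 ⟨hq, h⟩)
  have hDG : D ≤ G.card :=
    (Submodule.finrank_mono (span_le.2 hspan)).trans (finrank_span_finset_le_card G)
  have hfib : ∀ q ∈ G, ∃ x ∈ X, φ x = q := fun q hq =>
    Finset.mem_image.1 (Finset.mem_filter.1 hq).1
  choose! r hrX hr using hfib
  -- A sum `r q + x` with `x ∈ F` has image `q + p`. So it determines `q`, then `x`, and `q ∈ G`
  -- keeps it out of `X' + X'`.
  have hgain : (X' + X').card + D * F.card ≤ (X + X).card := by
    have hinj : Set.InjOn (fun z : W × Γ => r z.1 + z.2) (G ×ˢ F : Finset (W × Γ)) := by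
      rintro ⟨q, x⟩ h ⟨q', x'⟩ h' heq
      simp only [Finset.coe_product, Set.mem_prod, Finset.mem_coe] at h h'
      have hx := Finset.mem_filter.1 h.2
      have hx' := Finset.mem_filter.1 h'.2
      have h1 := hφ _ (hrX q h.1) _ hx.1 _ (hrX q' h'.1) _ hx'.1 heq
      rw [hr q h.1, hr q' h'.1, hx.2, hx'.2, add_left_inj] at h1
      subst h1
      simpa using heq
    have hdisj : Disjoint (X' + X') ((G ×ˢ F).image fun z : W × Γ => r z.1 + z.2) := by
      rw [Finset.disjoint_left]
      intro s hs hs'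
      obtain ⟨a, ha, b, hb, rfl⟩ := Finset.mem_add.1 hs
      obtain ⟨⟨q, x⟩, hz, heq⟩ := Finset.mem_image.1 hs'
      rw [Finset.mem_product] at hz
      have hx := Finset.mem_filter.1 hz.2
      have ha' := Finset.mem_filter.1 ha
      have hb' := Finset.mem_filter.1 hb
      have h1 := hφ _ (hrX q hz.1) _ hx.1 _ ha'.1 _ hb'.1 heq
      rw [hr q hz.1, hx.2, add_comm] at h1
      exact (Finset.mem_filter.1 hz.1).2 _ (Finset.mem_image_of_mem _ ha'.1) _
        (Finset.mem_image_of_mem _ hb'.1) ha'.2 hb'.2 h1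
    calc (X' + X').card + D * F.card ≤ (X' + X').card + G.card * F.card := by gcongr
      _ = (X' + X').card + ((G ×ˢ F).image fun z : W × Γ => r z.1 + z.2).card := by
        rw [Finset.card_image_of_injOn hinj, Finset.card_product]
      _ = ((X' + X') ∪ ((G ×ˢ F).image fun z : W × Γ => r z.1 + z.2)).card :=
        (Finset.card_union_of_disjoint hdisj).symm
      _ ≤ (X + X).card := by
        refine Finset.card_le_card (Finset.union_subset hsub fun s hs => ?_)
        obtain ⟨⟨q, x⟩, hz, rfl⟩ := Finset.mem_image.1 hs
        rw [Finset.mem_product] at hz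
        exact Finset.add_mem_add (hrX q hz.1) (hFX hz.2)
  by_cases hps : p ∈ span ℚ (X'.image φ : Set W)
  · have hDD : D ≤ D' := by
      refine Submodule.finrank_mono (span_le.2 fun w hw => ?_)
      obtain ⟨x, hx, rfl⟩ := Finset.mem_image.1 hw
      by_cases hxp : φ x = p
      · rw [hxp]; exact hps
      · exact subset_span (Finset.mem_image_of_mem _ (Finset.mem_filter.2 ⟨hx, hxp⟩))
    have := Nat.mul_le_mul_right X'.card hDD
    rw [← hsplit, mul_add]
    omega
  -- The dimension may now drop by one, which costs an extra `|X'|`. The translate `x₀ + X`,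
  -- disjoint from `X' + X'`, pays for it; adding this bound to `hgain` is where the factor 2 is
  -- needed.
  · have hgain' : (X' + X').card + X.card ≤ (X + X).card := by
      have hdisj : Disjoint (X' + X') (X.image fun x => x₀ + x) := by
        rw [Finset.disjoint_left]
        intro s hs hs'
        obtain ⟨a, ha, b, hb, rfl⟩ := Finset.mem_add.1 hs
        obtain ⟨x, hx, heq⟩ := Finset.mem_image.1 hs'
        have ha' := Finset.mem_filter.1 ha
        have hb' := Finset.mem_filter.1 hb
        have h1 := hφ _ hx₀ _ hx _ ha'.1 _ hb'.1 heq
        have ha'' : φ a ∈ span ℚ (X'.image φ : Set W) :=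
          subset_span (Finset.mem_image_of_mem _ ha)
        have hb'' : φ b ∈ span ℚ (X'.image φ : Set W) :=
          subset_span (Finset.mem_image_of_mem _ hb)
        by_cases hxp : φ x = p
        · rw [hxp, ← hp] at h1
          exact (add_lt_add ((hmax a ha'.1).lt_of_ne ha'.2)
            ((hmax b hb'.1).lt_of_ne hb'.2)).ne h1.symm
        · apply hps
          have : p = φ a + φ b - φ x := by rw [← h1]; abel
          rw [this]
          exact sub_mem (add_mem ha'' hb'')
            (subset_span (Finset.mem_image_of_mem _ (Finset.mem_filter.2 ⟨hx, hxp⟩)))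
      calc (X' + X').card + X.card = (X' + X').card + (X.image fun x => x₀ + x).card := by
            rw [Finset.card_image_of_injective _ (add_right_injective x₀)]
        _ = ((X' + X') ∪ (X.image fun x => x₀ + x)).card :=
          (Finset.card_union_of_disjoint hdisj).symm
        _ ≤ (X + X).card := by
          refine Finset.card_le_card (Finset.union_subset hsub fun s hs => ?_)
          obtain ⟨x, hx, rfl⟩ := Finset.mem_image.1 hs
          exact Finset.add_mem_add hx₀ hx
    have hDD : D ≤ D' + 1 := by
      have : D ≤ finrank ℚ (span ℚ ({p} : Set W) ⊔ span ℚ (X'.image φ : Set W) : Submodule ℚ W) := by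
        refine Submodule.finrank_mono (span_le.2 fun w hw => ?_)
        obtain ⟨x, hx, rfl⟩ := Finset.mem_image.1 hw
        by_cases hxp : φ x = p
        · rw [hxp]; exact mem_sup_left (mem_span_singleton_self p)
        · exact mem_sup_right
            (subset_span (Finset.mem_image_of_mem _ (Finset.mem_filter.2 ⟨hx, hxp⟩)))
      have h2 := Submodule.finrank_add_le_finrank_add_finrank (span ℚ ({p} : Set W))
        (span ℚ (X'.image φ : Set W))
      have h3 : finrank ℚ (span ℚ ({p} : Set W)) ≤ 1 := by
        simpa using finrank_span_le_card (R := ℚ) ({p} : Set W)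
      omega
    have := Nat.mul_le_mul_right X'.card hDD
    rw [add_mul, one_mul] at this
    have h4 : D * X.card = D * F.card + D * X'.card := by rw [← hsplit, mul_add]
    omega

/-! ### Rank modulo additive relations -/

/-- The `ℚ`-span of the six-term additive relations between the entries of a family `y`. -/
def additiveRelations {ι Γ : Type*} [DecidableEq ι] [AddCommGroup Γ] (y : ι → Γ) :
    Submodule ℚ (ι → ℚ) :=
  Submodule.span ℚ {v | ∃ a b : Fin 6 → ι, ∑ i, y (a i) = ∑ i, y (b i) ∧
    v = ∑ i, Pi.single (a i) 1 - ∑ i, Pi.single (b i) 1}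

/-- The rank of a finite family modulo its six-term additive relations. -/
noncomputable def additiveRank {ι Γ : Type*} [DecidableEq ι] [AddCommGroup Γ]
    (y : ι → Γ) : ℕ :=
  Module.finrank ℚ ((ι → ℚ) ⧸ additiveRelations y)

/-- Sending `y i` to the class of the `i`-th coordinate vector extends to `X` by `a + b - c ↦ f a +
f b - f c`. Six-term relations are what this extension needs to respect sums of two elements, so the
weighted Freiman lemma applies to it. -/
theorem additiveRank_mul_card_le {ι Γ : Type*} [Fintype ι] [DecidableEq ι] [AddCommGroup Γ]
    [DecidableEq Γ] (y : ι → Γ) (X : Finset Γ) (hyX : ∀ i, y i ∈ X)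
    (hX : ∀ x ∈ X, ∃ a b c, x = y a + y b - y c) :
    additiveRank y * X.card ≤ 2 * (X + X).card := by
  classical
  set r := additiveRank y with hr
  rcases X.eq_empty_or_nonempty with rfl | ⟨x₁, hx₁⟩
  · simp
  obtain ⟨i₁, -⟩ := hX x₁ hx₁
  have : Nonempty ι := ⟨i₁⟩
  -- The Freiman lemma needs an ordered space; the quotient gets the lexicographic order on
  -- coordinates.
  let e : ((ι → ℚ) ⧸ additiveRelations y) ≃ₗ[ℚ] Lex (Fin r → ℚ) :=
    (LinearEquiv.ofFinrankEq _ (Fin r → ℚ) (by rw [Module.finrank_fin_fun]; rfl)).trans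
      (toLexLinearEquiv ℚ (Fin r → ℚ))
  let ψ : (ι → ℚ) →ₗ[ℚ] Lex (Fin r → ℚ) := e.toLinearMap ∘ₗ (additiveRelations y).mkQ
  let f : ι → Lex (Fin r → ℚ) := fun i => ψ (Pi.single i 1)
  have hf : ∀ a b : Fin 6 → ι, ∑ i, y (a i) = ∑ i, y (b i) → ∑ i, f (a i) = ∑ i, f (b i) := by
    intro a b hab
    have h1 : (∑ i, Pi.single (a i) (1 : ℚ) - ∑ i, Pi.single (b i) 1 : ι → ℚ) ∈
        additiveRelations y := Submodule.subset_span ⟨a, b, hab, rfl⟩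
    have h2 : ψ (∑ i, Pi.single (a i) (1 : ℚ) - ∑ i, Pi.single (b i) 1) = 0 := by
      simp only [ψ, LinearMap.comp_apply, Submodule.mkQ_apply,
        (Submodule.Quotient.mk_eq_zero _).2 h1, map_zero]
    rw [map_sub, map_sum, map_sum, sub_eq_zero] at h2
    exact h2
  choose! A B C hABC using hX
  let φ : Γ → Lex (Fin r → ℚ) := fun x => f (A x) + f (B x) - f (C x)
  have hφ : ∀ a ∈ X, ∀ b ∈ X, ∀ c ∈ X, ∀ d ∈ X, a + b = c + d → φ a + φ b = φ c + φ d := by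
    intro a ha b hb c hc d hd h
    -- With the subtracted terms moved across, `a + b = c + d` has six entries of `y` on each side.
    have h1 := hf ![A a, B a, A b, B b, C c, C d] ![A c, B c, A d, B d, C a, C b] (by
      have h2 : y (A a) + y (B a) - y (C a) + (y (A b) + y (B b) - y (C b)) =
          y (A c) + y (B c) - y (C c) + (y (A d) + y (B d) - y (C d)) := by
        rw [← hABC a ha, ← hABC b hb, ← hABC c hc, ← hABC d hd, h]
      simp only [Fin.sum_univ_succ, Fin.sum_univ_zero, Matrix.cons_val_zero, Matrix.cons_val_succ]
      rw [← sub_eq_zero] at h2 ⊢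
      rw [← h2]; abel)
    simp only [Fin.sum_univ_succ, Fin.sum_univ_zero, Matrix.cons_val_zero,
      Matrix.cons_val_succ] at h1
    rw [← sub_eq_zero] at h1 ⊢
    rw [← h1]; simp only [φ]; abel
  have hφy : ∀ j, φ (y j) = f j := by
    intro j
    -- The relation `A + B = C + j`, padded with four copies of `j`.
    have h1 := hf ![A (y j), B (y j), j, j, j, j] ![C (y j), j, j, j, j, j] (by
      have h2 := hABC (y j) (hyX j)
      simp only [Fin.sum_univ_succ, Fin.sum_univ_zero, Matrix.cons_val_zero, Matrix.cons_val_succ]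
      rw [← sub_eq_zero] at h2 ⊢
      rw [← neg_eq_zero, ← h2]; abel)
    simp only [Fin.sum_univ_succ, Fin.sum_univ_zero, Matrix.cons_val_zero,
      Matrix.cons_val_succ] at h1
    rw [← sub_eq_zero] at h1 ⊢
    rw [← h1]; simp only [φ]; abel
  have hmain := finrank_span_image_mul_card_le φ X hφ
  have hspan : Submodule.span ℚ (φ '' X) = ⊤ := by
    rw [eq_top_iff]
    intro w _
    obtain ⟨v, rfl⟩ : ∃ v, ψ v = w :=
      (e.surjective.comp (additiveRelations y).mkQ_surjective) w
    have hv : ψ v = ∑ i, v i • f i := by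
      conv_lhs => rw [pi_eq_sum_univ' v]
      rw [map_sum]
      refine Finset.sum_congr rfl fun i _ => ?_
      rw [map_smul]
    rw [hv]
    refine Submodule.sum_mem _ fun i _ => Submodule.smul_mem _ _ (Submodule.subset_span ?_)
    exact ⟨y i, hyX i, hφy i⟩
  rw [hspan, finrank_top] at hmain
  rwa [← e.finrank_eq] at hmain

/-! ### Counting families of small rank -/

/-- If a nonempty set spans a space of dimension at most `n`, then `n` of its elements do. -/
theorem exists_fun_fin_span_eq {V : Type*} [AddCommGroup V] [Module ℚ V] (S : Set V)
    (hS : S.Nonempty) (n : ℕ) (hn : Module.finrank ℚ (Submodule.span ℚ S) ≤ n) [Module.Finite ℚ V] :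
    ∃ f : Fin n → V, (∀ i, f i ∈ S) ∧ Submodule.span ℚ (Set.range f) = Submodule.span ℚ S := by
  obtain ⟨g, hg, hspan, -⟩ := Submodule.exists_fun_fin_finrank_span_eq ℚ S
  obtain ⟨v, hv⟩ := hS
  refine ⟨fun i => if h : (i : ℕ) < Module.finrank ℚ (Submodule.span ℚ S) then g ⟨i, h⟩ else v,
    fun i => ?_, le_antisymm (Submodule.span_mono ?_) ?_⟩
  · dsimp only; split_ifs
    · exact hg _
    · exact hv
  · rintro _ ⟨i, rfl⟩
    dsimp only; split_ifs
    · exact hg _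
    · exact hv
  · refine hspan.ge.trans (Submodule.span_mono ?_)
    rintro _ ⟨i, rfl⟩
    exact ⟨⟨i, i.2.trans_le hn⟩, by simp⟩

/-- Pairing with `d` kills `V`, so it descends to the quotient, where it vanishes on a spanning set.
With `d` the difference of two integer lifts, this recovers a family from its relations and its
values at `g`. -/
theorem eq_zero_of_dotProduct_eq_zero {s r m : ℕ} (V : Submodule ℚ (Fin s → ℚ))
    (f : Fin m → Fin s → ℚ) (hf : Submodule.span ℚ (Set.range f) = V) (g : Fin r → Fin s)
    (hg : Submodule.span ℚ (Set.range fun i => V.mkQ (Pi.single (g i) 1)) = ⊤) (d : Fin s → ℚ)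
    (hd : ∀ i, f i ⬝ᵥ d = 0) (hdg : ∀ i, d (g i) = 0) : d = 0 := by
  let l : (Fin s → ℚ) →ₗ[ℚ] ℚ :=
    { toFun := fun v => v ⬝ᵥ d
      map_add' := fun v w => add_dotProduct v w d
      map_smul' := fun c v => smul_dotProduct c v d }
  have hV : V ≤ LinearMap.ker l := by
    rw [← hf, Submodule.span_le]
    rintro _ ⟨i, rfl⟩
    exact hd i
  have hker : V.liftQ l hV = 0 := by
    refine LinearMap.ext_on hg ?_
    rintro _ ⟨i, rfl⟩
    simp [l, hdg]
  ext i
  have h := LinearMap.congr_fun hker (V.mkQ (Pi.single i 1))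
  simpa [l] using h

/-- Passing to integer representatives makes linear algebra over `ℚ` available for every modulus.
The price is a carry, bounded because both sums lie in `[0, 6N]`. -/
theorem exists_relation_multiplier {N : ℕ} [NeZero N] {s : ℕ} (y : Fin s → ZMod N)
    (a b : Fin 6 → Fin s) (h : ∑ i, y (a i) = ∑ i, y (b i)) :
    ∃ j : Finset.Icc (-6 : ℤ) 6,
      ∑ i, ((y (a i)).val : ℤ) - ∑ i, ((y (b i)).val : ℤ) = N * (j : ℤ) := by
  have h1 : (((∑ i, ((y (a i)).val : ℤ) - ∑ i, ((y (b i)).val : ℤ) : ℤ)) : ZMod N) = 0 := by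
    push_cast
    simp [h]
  rw [ZMod.intCast_zmod_eq_zero_iff_dvd] at h1
  obtain ⟨j, hj⟩ := h1
  have hN : (0 : ℤ) < N := by exact_mod_cast NeZero.pos N
  have hbd : ∀ c : Fin 6 → Fin s,
      0 ≤ ∑ i, ((y (c i)).val : ℤ) ∧ ∑ i, ((y (c i)).val : ℤ) ≤ 6 * N := by
    intro c
    refine ⟨Finset.sum_nonneg fun i _ => by positivity, ?_⟩
    calc ∑ i, ((y (c i)).val : ℤ) ≤ ∑ i : Fin 6, (N : ℤ) :=
          Finset.sum_le_sum fun i _ => by exact_mod_cast (ZMod.val_lt _).le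
      _ = 6 * N := by simp
  have ha := hbd a
  have hb := hbd b
  refine ⟨⟨j, Finset.mem_Icc.2 ⟨?_, ?_⟩⟩, hj⟩
  · by_contra! hlt
    nlinarith
  · by_contra! hlt
    nlinarith

/-- The number of families of length `s` in `ℤ/Nℤ` of additive rank at most `r` is at most
`(13 s ^ 12) ^ s * (s N) ^ r`. -/
theorem card_filter_additiveRank_le {N : ℕ} [NeZero N] (s r : ℕ) (hs : 0 < s) :
    (Finset.univ.filter fun y : Fin s → ZMod N => additiveRank y ≤ r).card ≤
      (13 * s ^ 12) ^ s * (s * N) ^ r := by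
  classical
  have : NeZero s := ⟨hs.ne'⟩
  let Code := (Fin s → ((Fin 6 → Fin s) × (Fin 6 → Fin s)) × Finset.Icc (-6 : ℤ) 6) ×
    (Fin r → Fin s × ZMod N)
  -- The code of `y`: `s` relations spanning all of them, each with its carry, and `r` coordinates
  -- that span the quotient, each with its value.
  let R : (Fin s → ZMod N) → Code → Prop := fun y c =>
    (∀ i, ∑ t, ((y ((c.1 i).1.1 t)).val : ℤ) - ∑ t, ((y ((c.1 i).1.2 t)).val : ℤ) =
        N * ((c.1 i).2 : ℤ)) ∧
    (∀ i, y (c.2 i).1 = (c.2 i).2) ∧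
    Submodule.span ℚ (Set.range fun i => (∑ t, Pi.single ((c.1 i).1.1 t) 1 -
      ∑ t, Pi.single ((c.1 i).1.2 t) 1 : Fin s → ℚ)) = additiveRelations y ∧
    Submodule.span ℚ (Set.range fun i =>
      (additiveRelations y).mkQ (Pi.single (c.2 i).1 1)) = ⊤
  have hex : ∀ y : Fin s → ZMod N, additiveRank y ≤ r → ∃ c, R y c := by
    intro y hy
    obtain ⟨f, hf, hfspan⟩ := exists_fun_fin_span_eq {v : Fin s → ℚ | ∃ a b : Fin 6 → Fin s,
      ∑ i, y (a i) = ∑ i, y (b i) ∧ v = ∑ i, Pi.single (a i) 1 - ∑ i, Pi.single (b i) 1}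
      ⟨0, 0, 0, rfl, by simp⟩ s ((Submodule.finrank_le _).trans (by simp))
    choose a b hab hv using hf
    choose j hj using fun i => exists_relation_multiplier y (a i) (b i) (hab i)
    have htop : Submodule.span ℚ (Set.range fun i : Fin s =>
        (additiveRelations y).mkQ (Pi.single i 1)) = ⊤ := by
      rw [Set.range_comp' , Submodule.span_image]
      have : Submodule.span ℚ (Set.range fun i : Fin s => (Pi.single i 1 : Fin s → ℚ)) = ⊤ := by
        rw [← (Pi.basisFun ℚ (Fin s)).span_eq]
        congr 2
        ext i
        simp
      rw [this, Submodule.map_top, Submodule.range_mkQ]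
    obtain ⟨g, hg, hgspan⟩ := exists_fun_fin_span_eq (Set.range fun i : Fin s =>
        (additiveRelations y).mkQ (Pi.single i 1)) ⟨_, ⟨0, rfl⟩⟩ r
        (by rw [htop, finrank_top]; exact hy)
    choose G hG using hg
    refine ⟨(fun i => ((a i, b i), j i), fun i => (G i, y (G i))), hj, fun i => rfl, ?_, ?_⟩
    · rw [additiveRelations, ← hfspan]
      congr 2
      ext1 i
      exact (hv i).symm
    · rw [← htop, ← hgspan]
      congr 2
      ext1 i
      exact hG i
  have : Nonempty Code := ⟨(fun _ => ((0, 0), ⟨0, by simp⟩), fun _ => (0, 0))⟩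
  choose! code hcode using hex
  have hinj : Set.InjOn code
      (Finset.univ.filter fun y : Fin s → ZMod N => additiveRank y ≤ r : Finset _) := by
    intro y hy y' hy' hyy
    have h := hcode y (by simpa using hy)
    have h' := hcode y' (by simpa using hy')
    rw [← hyy] at h'
    obtain ⟨h1, h2, h3, h4⟩ := h
    obtain ⟨h1', h2', -, -⟩ := h'
    -- Equal carries cancel, so the difference of the lifts is orthogonal to the relations of `y`;
    -- further relations of `y'` play no role.
    have hd := eq_zero_of_dotProduct_eq_zero (additiveRelations y) _ h3 _ h4
      (fun i => ((y i).val : ℚ) - ((y' i).val : ℚ)) (fun i => by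
        have e1 := (h1 i).trans (h1' i).symm
        have e2 : (∑ t, ((y (((code y).1 i).1.1 t)).val : ℚ) -
            ∑ t, ((y (((code y).1 i).1.2 t)).val : ℚ)) =
            (∑ t, ((y' (((code y).1 i).1.1 t)).val : ℚ) -
            ∑ t, ((y' (((code y).1 i).1.2 t)).val : ℚ)) := by exact_mod_cast e1
        simp only [sub_dotProduct, sum_dotProduct, single_dotProduct, one_mul,
          Finset.sum_sub_distrib]
        linarith) (fun i => by rw [h2, h2', sub_self])
    ext i
    have := congrFun hd i
    simp only [Pi.zero_apply, sub_eq_zero, Nat.cast_inj] at this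
    exact ZMod.val_injective N this
  calc _ ≤ (Finset.univ : Finset Code).card :=
        Finset.card_le_card_of_injOn code (fun _ _ => Finset.mem_univ _) hinj
    _ = (13 * s ^ 12) ^ s * (s * N) ^ r := by
      rw [show 13 * s ^ 12 = s ^ 6 * s ^ 6 * 13 by ring]
      simp [Code, ZMod.card]

/-! ### Small subsets that cover a set or keep most of its sums -/

/-- A finite set `X` is contained in `Y + Y - Y` for some `Y ⊆ X` of size about
`2 * √|X + X|`. -/
theorem exists_small_subset_add_sub {Γ : Type*} [AddCommGroup Γ] [DecidableEq Γ] (X : Finset Γ)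
    (hX : X.Nonempty) :
    ∃ Y ⊆ X, Y.card ≤ 2 * Nat.sqrt (X + X).card + 2 ∧
      ∀ x ∈ X, ∃ a ∈ Y, ∃ b ∈ Y, ∃ c ∈ Y, x = a + b - c := by
  set m := (X + X).card with hm
  set z := Nat.sqrt m with hz
  have hm0 : 0 < m := Finset.card_pos.2 (hX.add hX)
  have hz0 : 0 < z := Nat.sqrt_pos.2 hm0
  have hzk : z ≤ X.card := by
    have h1 : m ≤ X.card * X.card := Finset.card_add_le
    exact (Nat.sqrt_le_sqrt h1).trans (Nat.sqrt_eq _).le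
  obtain ⟨Z, hZX, hZ⟩ := Finset.exists_subset_card_eq hzk
  have hZne : Z.Nonempty := Finset.card_pos.1 (hZ ▸ hz0)
  have hzR : (0 : ℝ) < z := by exact_mod_cast hz0
  -- Size `√m` balances `|Z|` against the number `m / |Z|` of covering translates.
  obtain ⟨F, hFX, hF, hcov⟩ := Finset.ruzsa_covering_add (A := X) (B := Z) (K := (m : ℝ) / z) hZne
    (by
      rw [hZ, div_mul_cancel₀ _ hzR.ne']
      exact_mod_cast Finset.card_le_card (Finset.add_subset_add_left hZX))
  have hFcard : F.card ≤ z + 2 := by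
    rw [le_div_iff₀ hzR] at hF
    have h1 : F.card * z ≤ m := by exact_mod_cast hF
    have h2 : m ≤ z * z + z + z := Nat.sqrt_le_add m
    exact Nat.le_of_mul_le_mul_right (by nlinarith) hz0
  refine ⟨F ∪ Z, Finset.union_subset hFX hZX, (Finset.card_union_le _ _).trans (by omega),
    fun x hx => ?_⟩
  obtain ⟨f, hf, w, hw, rfl⟩ := Finset.mem_add.1 (hcov hx)
  obtain ⟨b, hb, c, hc, rfl⟩ := Finset.mem_sub.1 hw
  exact ⟨f, Finset.mem_union_left _ hf, b, Finset.mem_union_right _ hb, c,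
    Finset.mem_union_right _ hc, by abel⟩

/-- If every member of a finite family of subsets of `X` has at least `u` elements, then some set of
at most `16 * |P| / u` elements of `X` meets all but `|X| / 16` of them. -/
theorem exists_hitting_set {α β : Type*} [DecidableEq α] [DecidableEq β] (X : Finset α)
    (P : Finset β) (R : β → α → Prop) [∀ s x, Decidable (R s x)] (u : ℕ) (hu : 0 < u)
    (h : ∀ s ∈ P, u ≤ (X.filter (R s)).card) :
    ∃ Y ⊆ X, Y.card * u ≤ 16 * P.card ∧
      16 * P.card ≤ 16 * (P.filter fun s => ∃ x ∈ Y, R s x).card + X.card := by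
  -- Maximising this trade-off replaces a greedy choice. Comparison with `∅` bounds `|Y|`;
  -- comparison with `insert x Y` shows that each `x` lies in at most `u / 16` of the missed sets.
  obtain ⟨Y, hY, hmax⟩ := Finset.exists_max_image X.powerset
    (fun Y => (16 * (P.filter fun s => ∃ x ∈ Y, R s x).card : ℤ) - u * Y.card)
    ⟨∅, Finset.empty_mem_powerset X⟩
  rw [Finset.mem_powerset] at hY
  set C := P.filter fun s => ∃ x ∈ Y, R s x with hC
  set D := P.filter fun s => ¬ ∃ x ∈ Y, R s x with hD
  have hCD : C.card + D.card = P.card := Finset.card_filter_add_card_filter_not _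
  refine ⟨Y, hY, ?_, ?_⟩
  · have h1 := hmax ∅ (Finset.empty_mem_powerset X)
    simp at h1
    have : u * Y.card ≤ 16 * C.card := by exact_mod_cast h1
    rw [mul_comm]
    omega
  · have hgain : ∀ x ∈ X, 16 * (D.filter fun s => R s x).card ≤ u := by
      intro x hx
      by_cases hxY : x ∈ Y
      · rw [Finset.filter_eq_empty_iff.2, Finset.card_empty]
        · omega
        · intro s hs hR
          exact (Finset.mem_filter.1 hs).2 ⟨x, hxY, hR⟩
      · have h1 := hmax (insert x Y) (Finset.mem_powerset.2 (Finset.insert_subset hx hY))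
        have h2 : (P.filter fun s => ∃ x' ∈ insert x Y, R s x') =
            C ∪ D.filter fun s => R s x := by
          ext s
          simp only [hC, hD, Finset.mem_filter, Finset.mem_union, Finset.mem_insert]
          constructor
          · rintro ⟨hs, x', rfl | hx', hR⟩
            · by_cases h' : ∃ x' ∈ Y, R s x'
              · exact Or.inl ⟨hs, h'⟩
              · exact Or.inr ⟨⟨hs, h'⟩, hR⟩
            · exact Or.inl ⟨hs, x', hx', hR⟩
          · rintro (⟨hs, x', hx', hR⟩ | ⟨⟨hs, -⟩, hR⟩)
            · exact ⟨hs, x', Or.inr hx', hR⟩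
            · exact ⟨hs, x, Or.inl rfl, hR⟩
        have h3 : Disjoint C (D.filter fun s => R s x) :=
          (Finset.disjoint_filter_filter_not P P _).mono_right (Finset.filter_subset _ _)
        rw [h2, Finset.card_union_of_disjoint h3, Finset.card_insert_of_notMem hxY] at h1
        push_cast at h1
        have : (16 * (D.filter fun s => R s x).card : ℤ) ≤ u := by linarith
        exact_mod_cast this
    have hdouble : ∑ s ∈ D, (X.filter (R s)).card = ∑ x ∈ X, (D.filter fun s => R s x).card := by
      simp only [Finset.card_filter]
      exact Finset.sum_comm
    have hlow : D.card * u ≤ ∑ s ∈ D, (X.filter (R s)).card := by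
      rw [← smul_eq_mul]
      exact Finset.card_nsmul_le_sum _ _ _ fun s hs => h s (Finset.mem_filter.1 hs).1
    have hup : 16 * ∑ x ∈ X, (D.filter fun s => R s x).card ≤ X.card * u := by
      rw [Finset.mul_sum, ← smul_eq_mul (a := X.card)]
      exact Finset.sum_le_card_nsmul _ _ _ hgain
    have : 16 * D.card ≤ X.card := Nat.le_of_mul_le_mul_right (by
      calc 16 * D.card * u = 16 * (D.card * u) := by ring
        _ ≤ _ := (Nat.mul_le_mul_left 16 (hlow.trans_eq hdouble)).trans hup) hu
    change 16 * P.card ≤ 16 * C.card + X.card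
    omega

/-- A set of small doubling has disjoint subsets of size `O(√|X|)` whose sumset has at least
`3 / 4 * |X|` elements. -/
theorem exists_small_subsets_card_add_ge {Γ : Type*} [AddCommGroup Γ] [DecidableEq Γ]
    (X : Finset Γ) (hk : 4096 ^ 2 ≤ X.card) (hm : (X + X).card ≤ 32 * X.card) :
    ∃ Y₁ ⊆ X, ∃ Y₂ ⊆ X, Disjoint Y₁ Y₂ ∧ Y₁.card ≤ 512 * Nat.sqrt X.card ∧
      Y₂.card * Nat.sqrt X.card ≤ 512 * X.card ∧ 3 * X.card ≤ 4 * (Y₁ + Y₂).card := by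
  set k := X.card with hkdef
  set u := Nat.sqrt k with hu
  have hu0 : 4096 ≤ u := Nat.le_sqrt'.2 hk
  have huk : u * u ≤ k := Nat.sqrt_le k
  have htk : 4096 * u ≤ k := (Nat.mul_le_mul_right u hu0).trans huk
  obtain ⟨Y₁, hY₁X, hY₁⟩ := Finset.exists_subset_card_eq (show 512 * u ≤ X.card by omega)
  set X₂ := X \ Y₁ with hX₂
  have hX₂card : X₂.card + 512 * u = k := by
    rw [hX₂, ← hY₁, Finset.card_sdiff_add_card_eq_card hY₁X]
  -- Popular sums. The others, at most `32k` in number, carry at most `32k * u` of the `|X₂| * 512u`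
  -- representations, so `|P| ≥ |X₂| - k/16`. Removing `Y₁` costs `512u ≤ k/8` and the hitting set
  -- `k/16`, for a total loss of `k/4`.
  set P := (X + X).filter fun s => u ≤ (X₂.filter fun x => s - x ∈ Y₁).card with hP
  have hcount : ∑ s ∈ X + X, (X₂.filter fun x => s - x ∈ Y₁).card = X₂.card * (512 * u) := by
    simp only [Finset.card_filter]
    rw [Finset.sum_comm, ← smul_eq_mul, ← hY₁]
    refine Finset.sum_eq_card_nsmul fun x hx => ?_
    rw [← Finset.card_filter]
    refine Finset.card_bij' (fun s _ => s - x) (fun y _ => y + x) ?_ ?_ ?_ ?_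
    · intro s hs
      exact (Finset.mem_filter.1 hs).2
    · intro y hy
      simp only [Finset.mem_filter, add_sub_cancel_right]
      exact ⟨Finset.add_mem_add (hY₁X hy) (Finset.sdiff_subset hx), hy⟩
    · intro s _
      exact sub_add_cancel _ _
    · intro y _
      exact add_sub_cancel_right _ _
  have hle : ∀ s, (X₂.filter fun x => s - x ∈ Y₁).card ≤ 512 * u := by
    intro s
    rw [← hY₁]
    refine Finset.card_le_card_of_injOn (fun x => s - x)
      (fun x hx => (Finset.mem_filter.1 hx).2) ?_
    intro x _ x' _ h
    exact sub_right_injective h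
  have hPcard : 16 * k ≤ 16 * P.card + k + 16 * (512 * u) := by
    have h1 : X₂.card * (512 * u) ≤ P.card * (512 * u) + (32 * k) * u := by
      rw [← hcount, ← Finset.sum_filter_add_sum_filter_not (X + X)
        (fun s => u ≤ (X₂.filter fun x => s - x ∈ Y₁).card)]
      refine add_le_add ?_ ?_
      · rw [← smul_eq_mul]
        exact Finset.sum_le_card_nsmul _ _ _ fun s _ => hle s
      · refine (Finset.sum_le_card_nsmul _ _ u fun s hs => ?_).trans ?_
        · exact (not_le.1 (Finset.mem_filter.1 hs).2).le
        · rw [smul_eq_mul]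
          exact Nat.mul_le_mul_right u ((Finset.card_filter_le _ _).trans hm)
    have h2 : 512 * X₂.card ≤ 512 * P.card + 32 * k :=
      Nat.le_of_mul_le_mul_right (c := u) (by linarith) (by omega)
    omega
  obtain ⟨Y₂, hY₂, hY₂card, hhit⟩ := exists_hitting_set X₂ P (fun s x => s - x ∈ Y₁) u (by omega)
    (fun s hs => (Finset.mem_filter.1 hs).2)
  have hsub : (P.filter fun s => ∃ x ∈ Y₂, s - x ∈ Y₁) ⊆ Y₁ + Y₂ := by
    intro s hs
    obtain ⟨x, hx, hsx⟩ := (Finset.mem_filter.1 hs).2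
    exact Finset.mem_add.2 ⟨s - x, hsx, x, hx, sub_add_cancel _ _⟩
  have hPm : P.card ≤ 32 * k := (Finset.card_filter_le _ _).trans hm
  have hcard := Finset.card_le_card hsub
  exact ⟨Y₁, hY₁X, Y₂, hY₂.trans Finset.sdiff_subset,
    Finset.disjoint_sdiff.mono_right hY₂, hY₁.le, by omega, by omega⟩

/-! ### Union bound over structured witnesses -/

/-- The sums of two distinct elements of `X`. -/
def distinctSums {Γ : Type*} [AddCommGroup Γ] [DecidableEq Γ] (X : Finset Γ) : Finset Γ :=
  X.offDiag.image fun p => p.1 + p.2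

theorem distinctSums_mono {Γ : Type*} [AddCommGroup Γ] [DecidableEq Γ] {X Y : Finset Γ}
    (h : X ⊆ Y) : distinctSums X ⊆ distinctSums Y :=
  Finset.image_subset_image (Finset.offDiag_mono h)

theorem add_subset_distinctSums {Γ : Type*} [AddCommGroup Γ] [DecidableEq Γ] {Y₁ Y₂ Y : Finset Γ}
    (h₁ : Y₁ ⊆ Y) (h₂ : Y₂ ⊆ Y) (h : Disjoint Y₁ Y₂) : Y₁ + Y₂ ⊆ distinctSums Y := by
  intro s hs
  obtain ⟨a, ha, b, hb, rfl⟩ := Finset.mem_add.1 hs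
  refine Finset.mem_image.2 ⟨(a, b), Finset.mem_offDiag.2 ⟨h₁ ha, h₂ hb,
    fun hab => ?_⟩, rfl⟩
  exact Finset.disjoint_left.1 h ha ((show a = b from hab) ▸ hb)

theorem card_add_le_card_distinctSums {Γ : Type*} [AddCommGroup Γ] [DecidableEq Γ]
    (X : Finset Γ) : (X + X).card ≤ (distinctSums X).card + X.card := by
  have : X + X ⊆ distinctSums X ∪ X.image fun x => x + x := by
    intro s hs
    obtain ⟨a, ha, b, hb, rfl⟩ := Finset.mem_add.1 hs
    by_cases hab : a = b
    · subst hab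
      exact Finset.mem_union_right _ (Finset.mem_image_of_mem (fun x => x + x) ha)
    · exact Finset.mem_union_left _
        (Finset.mem_image.2 ⟨(a, b), Finset.mem_offDiag.2 ⟨ha, hb, hab⟩, rfl⟩)
  calc (X + X).card ≤ _ := Finset.card_le_card this
    _ ≤ _ := Finset.card_union_le _ _
    _ ≤ _ := Nat.add_le_add_left Finset.card_image_le _

/-- Union bound: the proportion of subsets of `Γ` that contain one of the sets `W c` is at most
`∑ 2 ^ (-|W c|)`. -/
theorem card_subtype_div_le_sum {Γ ι : Type*} [Fintype Γ] [DecidableEq Γ] (T : Finset ι)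
    (W : ι → Finset Γ) (bad : Set Γ → Prop) (h : ∀ A, bad A → ∃ c ∈ T, (W c : Set Γ) ⊆ A) :
    (Nat.card {A : Set Γ // bad A} : ℝ) / Nat.card (Set Γ) ≤ ∑ c ∈ T, (1 / 2 : ℝ) ^ (W c).card := by
  classical
  have hcard : Nat.card {A : Set Γ // bad A} =
      (Finset.univ.filter fun A : Finset Γ => bad A).card := by
    rw [← Fintype.card_subtype, ← Nat.card_eq_fintype_card]
    exact Nat.card_congr (Fintype.finsetEquivSet.subtypeEquiv fun A => Iff.rfl).symm
  have htot : Nat.card (Set Γ) = 2 ^ Fintype.card Γ := by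
    rw [Nat.card_eq_fintype_card, Fintype.card_set]
  have hle : (Finset.univ.filter fun A : Finset Γ => bad A).card ≤
      ∑ c ∈ T, 2 ^ (Fintype.card Γ - (W c).card) := by
    calc _ ≤ (T.biUnion fun c => Finset.Icc (W c) Finset.univ).card := by
          refine Finset.card_le_card fun A hA => ?_
          obtain ⟨c, hc, hWA⟩ := h A (Finset.mem_filter.1 hA).2
          exact Finset.mem_biUnion.2 ⟨c, hc, Finset.mem_Icc.2
            ⟨Finset.coe_subset.1 hWA, Finset.subset_univ _⟩⟩
      _ ≤ ∑ c ∈ T, (Finset.Icc (W c) Finset.univ).card := Finset.card_biUnion_le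
      _ = _ := Finset.sum_congr rfl fun c _ => by
          rw [Finset.card_Icc_finset (Finset.subset_univ _), Finset.card_univ]
  rw [hcard, htot]
  push_cast
  rw [div_le_iff₀ (by positivity), Finset.sum_mul]
  refine (Nat.cast_le.2 hle).trans_eq ?_
  push_cast
  refine Finset.sum_congr rfl fun c _ => ?_
  rw [pow_sub₀ _ two_ne_zero (Finset.card_le_univ _), one_div, inv_pow, mul_comm]

theorem exists_fun_image_univ_eq {Γ : Type*} [DecidableEq Γ] (Y : Finset Γ) (hY : Y.Nonempty)
    (s : ℕ) (hs : Y.card ≤ s) : ∃ y : Fin s → Γ, Finset.univ.image y = Y := by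
  obtain ⟨a, ha⟩ := hY
  let e := Y.equivFin
  refine ⟨fun i => if h : (i : ℕ) < Y.card then e.symm ⟨i, h⟩ else a, ?_⟩
  ext x
  simp only [Finset.mem_image, Finset.mem_univ, true_and]
  constructor
  · rintro ⟨i, rfl⟩
    split_ifs
    · exact (e.symm _).2
    · exact ha
  · intro hx
    exact ⟨⟨e ⟨x, hx⟩, (e ⟨x, hx⟩).2.trans_le hs⟩, by simp⟩

/-- A nonempty set `Y ⊆ X` with `X ⊆ Y + Y - Y` is the image of a family of small additive rank. -/
theorem exists_fun_additiveRank_le {Γ : Type*} [AddCommGroup Γ] [DecidableEq Γ] {X Y : Finset Γ}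
    (hX : X.Nonempty) (hYX : Y ⊆ X)
    (hcov : ∀ x ∈ X, ∃ a ∈ Y, ∃ b ∈ Y, ∃ c ∈ Y, x = a + b - c) (s : ℕ) (hs : Y.card ≤ s) :
    ∃ y : Fin s → Γ, Finset.univ.image y = Y ∧ additiveRank y ≤ 2 * (X + X).card / X.card := by
  obtain ⟨x₀, hx₀⟩ := hX
  obtain ⟨a₀, ha₀, -⟩ := hcov x₀ hx₀
  obtain ⟨y, rfl⟩ := exists_fun_image_univ_eq Y ⟨a₀, ha₀⟩ s hs
  refine ⟨y, rfl, ?_⟩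
  rw [Nat.le_div_iff_mul_le (Finset.card_pos.2 ⟨x₀, hx₀⟩)]
  refine additiveRank_mul_card_le y X
    (fun i => hYX (Finset.mem_image_of_mem y (Finset.mem_univ i))) fun x hx => ?_
  obtain ⟨a, ha, b, hb, c, hc, rfl⟩ := hcov x hx
  obtain ⟨i, -, rfl⟩ := Finset.mem_image.1 ha
  obtain ⟨j, -, rfl⟩ := Finset.mem_image.1 hb
  obtain ⟨l, -, rfl⟩ := Finset.mem_image.1 hc
  exact ⟨i, j, l, rfl⟩

/-- The number of `k`-element sets `X` in `ℤ/Nℤ` with `|X + X| = m`. -/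
theorem card_filter_card_add_eq_le {N : ℕ} [NeZero N] (k m : ℕ) (hk : 0 < k) :
    (Finset.univ.filter fun X : Finset (ZMod N) => X.card = k ∧ (X + X).card = m).card ≤
      (13 * (2 * Nat.sqrt m + 2) ^ 12) ^ (2 * Nat.sqrt m + 2) *
        ((2 * Nat.sqrt m + 2) * N) ^ (2 * m / k) * (m ^ 3 / k ^ 2).choose k := by
  classical
  set s := 2 * Nat.sqrt m + 2 with hs
  set C := (Finset.univ.filter fun y : Fin s → ZMod N => additiveRank y ≤ 2 * m / k) with hC
  let I : (Fin s → ZMod N) → Finset (ZMod N) := fun y => Finset.univ.image y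
  let T : (Fin s → ZMod N) → Finset (Finset (ZMod N)) := fun y =>
    if (I y + I y - I y).card ≤ m ^ 3 / k ^ 2 then (I y + I y - I y).powersetCard k else ∅
  calc _ ≤ (C.biUnion T).card := by
        refine Finset.card_le_card fun X hX => ?_
        obtain ⟨hXk, hXm⟩ := (Finset.mem_filter.1 hX).2
        have hXne : X.Nonempty := Finset.card_pos.1 (hXk ▸ hk)
        obtain ⟨Y, hYX, hYcard, hcov⟩ := exists_small_subset_add_sub X hXne
        rw [hXm] at hYcard
        obtain ⟨y, hy, hrank⟩ := exists_fun_additiveRank_le hXne hYX hcov s hYcard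
        rw [hXm, hXk] at hrank
        -- Plünnecke–Ruzsa with doubling `m/k`: `|2X - X| ≤ (m/k)³ k`.
        have hsmall : (I y + I y - I y).card ≤ m ^ 3 / k ^ 2 := by
          have h1 : I y + I y - I y ⊆ 2 • X - 1 • X := by
            rw [one_nsmul, two_nsmul]
            simp only [I, hy]
            exact Finset.sub_subset_sub (Finset.add_subset_add hYX hYX) hYX
          have h2 := Finset.pluennecke_ruzsa_inequality_nsmul_sub_nsmul_add hXne X 2 1
          have h3 := (Nat.cast_le (α := NNRat).2 (Finset.card_le_card h1)).trans h2
          rw [hXk, hXm] at h3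
          rw [Nat.le_div_iff_mul_le (by positivity)]
          have hk0 : (k : NNRat) ≠ 0 := by exact_mod_cast hk.ne'
          have h4 : ((m : NNRat) / k) ^ (2 + 1) * k * k ^ 2 = m ^ 3 := by
            rw [div_pow]; field_simp; ring
          have h5 : ((I y + I y - I y).card : NNRat) * k ^ 2 ≤ m ^ 3 := by
            rw [← h4]; gcongr
          exact_mod_cast h5
        refine Finset.mem_biUnion.2 ⟨y, Finset.mem_filter.2 ⟨Finset.mem_univ _, hrank⟩, ?_⟩
        simp only [T]
        rw [if_pos hsmall, Finset.mem_powersetCard]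
        refine ⟨fun x hx => ?_, hXk⟩
        obtain ⟨a, ha, b, hb, c, hc, rfl⟩ := hcov x hx
        rw [← hy] at ha hb hc
        exact Finset.sub_mem_sub (Finset.add_mem_add ha hb) hc
    _ ≤ ∑ y ∈ C, (T y).card := Finset.card_biUnion_le
    _ ≤ ∑ y ∈ C, (m ^ 3 / k ^ 2).choose k := by
        refine Finset.sum_le_sum fun y _ => ?_
        simp only [T]
        split_ifs with h
        · rw [Finset.card_powersetCard]
          exact Nat.choose_le_choose k h
        · simp
    _ = C.card * (m ^ 3 / k ^ 2).choose k := by rw [Finset.sum_const, smul_eq_mul]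
    _ ≤ _ := Nat.mul_le_mul_right _ (card_filter_additiveRank_le s _ (by omega))

/-- The probability that a set `A` contains all sums of distinct elements of some `k`-element set
is at most the expected number of structured witnesses. -/
theorem card_subtype_distinctSums_div_le {N : ℕ} [NeZero N] (k : ℕ) (hk : 4096 ^ 2 ≤ k) :
    (Nat.card {A : Set (ZMod N) // ∃ X : Finset (ZMod N), X.card = k ∧
        (distinctSums X : Set (ZMod N)) ⊆ A} : ℝ) / Nat.card (Set (ZMod N)) ≤
      (13 * (2000 * Nat.sqrt k : ℝ) ^ 12) ^ (2000 * Nat.sqrt k) *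
        ((2000 * Nat.sqrt k) * N) ^ 64 * (1 / 2 : ℝ) ^ (k - k / 4) +
      ∑ m ∈ Finset.Icc (32 * k) (k * k),
        (13 * (2 * Nat.sqrt m + 2 : ℝ) ^ 12) ^ (2 * Nat.sqrt m + 2) *
        ((2 * Nat.sqrt m + 2) * N) ^ (2 * m / k) * (m ^ 3 / k ^ 2).choose k *
          (1 / 2 : ℝ) ^ (m - k) := by
  classical
  set s := 2000 * Nat.sqrt k with hs
  have hk0 : 0 < k := by omega
  have hu0 : 4096 ≤ Nat.sqrt k := Nat.le_sqrt'.2 hk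
  let C : Finset (Fin s → ZMod N) := Finset.univ.filter fun y => additiveRank y ≤ 64 ∧
    k - k / 4 ≤ (distinctSums (Finset.univ.image y)).card
  let T : ℕ → Finset (Finset (ZMod N)) := fun m =>
    Finset.univ.filter fun X => X.card = k ∧ (X + X).card = m
  let B := (Finset.Icc (32 * k) (k * k)).sigma T
  have hunion := card_subtype_div_le_sum (C.disjSum B)
    (Sum.elim (fun y => distinctSums (Finset.univ.image y)) (fun X => distinctSums X.2))
    (fun A : Set (ZMod N) => ∃ X : Finset (ZMod N), X.card = k ∧
        (distinctSums X : Set (ZMod N)) ⊆ A) (by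
      rintro A ⟨X, hXk, hXA⟩
      have hXne : X.Nonempty := Finset.card_pos.1 (hXk ▸ hk0)
      by_cases hm : (X + X).card < 32 * k
      · obtain ⟨Y₁, h₁, Y₂, h₂, hdisj, hc₁, hc₂, hlarge⟩ :=
          exists_small_subsets_card_add_ge X (by rwa [hXk]) (by rw [hXk]; exact hm.le)
        obtain ⟨Y₃, h₃, hc₃, hcov⟩ := exists_small_subset_add_sub X hXne
        rw [hXk] at hc₁ hc₂ hlarge
        have hku : k ≤ Nat.sqrt k * Nat.sqrt k + Nat.sqrt k + Nat.sqrt k := Nat.sqrt_le_add k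
        have hku2 : k ≤ 2 * (Nat.sqrt k * Nat.sqrt k) := by nlinarith
        have hc₂' : Y₂.card ≤ 1024 * Nat.sqrt k :=
          Nat.le_of_mul_le_mul_right (c := Nat.sqrt k) (by nlinarith) (by omega)
        have hsm : Nat.sqrt (X + X).card ≤ 8 * Nat.sqrt k := by
          rw [← Nat.sqrt_eq (8 * Nat.sqrt k)]
          exact Nat.sqrt_le_sqrt (by nlinarith)
        -- `Y₁` and `Y₂` supply the sums, `Y₃` the covering that bounds the rank; the sizes add up
        -- to at most `(512 + 1024 + 16)√k + 2`.
        have hYcard : (Y₁ ∪ Y₂ ∪ Y₃).card ≤ s := by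
          have e1 := Finset.card_union_le (Y₁ ∪ Y₂) Y₃
          have e2 := Finset.card_union_le Y₁ Y₂
          omega
        have hYX : Y₁ ∪ Y₂ ∪ Y₃ ⊆ X := Finset.union_subset (Finset.union_subset h₁ h₂) h₃
        obtain ⟨y, hy, hrank⟩ := exists_fun_additiveRank_le hXne hYX (fun x hx => by
          obtain ⟨a, ha, b, hb, c, hc, h⟩ := hcov x hx
          exact ⟨a, Finset.mem_union_right _ ha, b, Finset.mem_union_right _ hb, c,
            Finset.mem_union_right _ hc, h⟩) s hYcard
        refine ⟨Sum.inl y, Finset.inl_mem_disjSum.2 (Finset.mem_filter.2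
          ⟨Finset.mem_univ _, ?_, ?_⟩), ?_⟩
        · refine hrank.trans ?_
          rw [hXk]
          exact (Nat.div_lt_of_lt_mul (by omega)).le
        · rw [hy]
          have := Finset.card_le_card (add_subset_distinctSums (Y := Y₁ ∪ Y₂ ∪ Y₃)
            (Finset.subset_union_left.trans Finset.subset_union_left)
            (Finset.subset_union_right.trans Finset.subset_union_left) hdisj)
          omega
        · simp only [Sum.elim_inl, hy]
          exact (Finset.coe_subset.2 (distinctSums_mono hYX)).trans hXA
      · refine ⟨Sum.inr ⟨(X + X).card, X⟩, Finset.inr_mem_disjSum.2 (Finset.mem_sigma.2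
          ⟨Finset.mem_Icc.2 ⟨not_lt.1 hm, ?_⟩, Finset.mem_filter.2 ⟨Finset.mem_univ _, hXk, rfl⟩⟩),
          hXA⟩
        have := Finset.card_add_le (s := X) (t := X)
        rwa [hXk] at this)
  refine hunion.trans ?_
  rw [Finset.sum_disjSum, Finset.sum_sigma]
  refine add_le_add ?_ (Finset.sum_le_sum fun m _ => ?_)
  · have hC : (C.card : ℝ) ≤ (13 * (s : ℝ) ^ 12) ^ s * ((s : ℝ) * N) ^ 64 := by
      have h1 := (Finset.card_le_card (show C ⊆ Finset.univ.filter fun y => additiveRank y ≤ 64 from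
        fun y hy => Finset.mem_filter.2 ⟨Finset.mem_univ _, (Finset.mem_filter.1 hy).2.1⟩)).trans
        (card_filter_additiveRank_le (N := N) s 64 (by omega))
      exact_mod_cast h1
    have hs' : (s : ℝ) = 2000 * Nat.sqrt k := by rw [hs]; push_cast; rfl
    rw [← hs']
    refine (Finset.sum_le_card_nsmul C _ ((1 / 2 : ℝ) ^ (k - k / 4)) fun y hy => ?_).trans ?_
    · exact pow_le_pow_of_le_one (by norm_num) (by norm_num) (Finset.mem_filter.1 hy).2.2
    · rw [nsmul_eq_mul]
      gcongr
  · refine (Finset.sum_le_card_nsmul (T m) _ ((1 / 2 : ℝ) ^ (m - k)) fun X hX => ?_).trans ?_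
    · obtain ⟨hXk, hXm⟩ := (Finset.mem_filter.1 hX).2
      refine pow_le_pow_of_le_one (by norm_num) (by norm_num) ?_
      have := card_add_le_card_distinctSums X
      simp only [Sum.elim_inr]
      omega
    · rw [nsmul_eq_mul]
      gcongr
      exact_mod_cast card_filter_card_add_eq_le (N := N) k m hk0

/-! ### Size estimates -/

/-- The logarithm of the left side is `O(√n log n)`. The factor `s ^ s` is there to absorb `s ^ r`,
since the rank bound `r` is at most `s` in both applications. -/
theorem eventually_code_le_two_rpow : ∀ᶠ n : ℕ in atTop, ∀ s : ℕ, 0 < s →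
    s ≤ 2000 * Nat.sqrt n → ((13 * (s : ℝ) ^ 12) ^ s * (s : ℝ) ^ s) ≤ 2 ^ ((n : ℝ) / 16) := by
  have hlog2 : 0 < Real.log 2 := Real.log_pos (by norm_num)
  have h1 : (fun x : ℝ => 2000 * (Real.log 13 + 13 * Real.log 2000) + 26000 * Real.log x)
      =o[atTop] (id : ℝ → ℝ) :=
    (Asymptotics.isLittleO_const_id_atTop _).add (Real.isLittleO_log_id_atTop.const_mul_left _)
  have h2 := h1.bound (show 0 < Real.log 2 / 16 by positivity)
  have h3 : Tendsto (fun n : ℕ => √(n : ℝ)) atTop atTop :=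
    Real.tendsto_sqrt_atTop.comp tendsto_natCast_atTop_atTop
  filter_upwards [h3.eventually h2, eventually_gt_atTop 0] with n hn hn0 s hs hsn
  have hx0 : 0 < √(n : ℝ) := Real.sqrt_pos.2 (by exact_mod_cast hn0)
  set x := √(n : ℝ) with hx
  have hxx : x * x = n := Real.mul_self_sqrt (Nat.cast_nonneg n)
  have hsR : (0 : ℝ) < s := by exact_mod_cast hs
  have hsx : (s : ℝ) ≤ 2000 * x := by
    have h4 : (s : ℝ) ≤ 2000 * (Nat.sqrt n : ℝ) := by exact_mod_cast hsn
    have h5 : (Nat.sqrt n : ℝ) ≤ x := Real.nat_sqrt_le_real_sqrt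
    linarith
  have hlogs : Real.log s ≤ Real.log 2000 + Real.log x := by
    rw [← Real.log_mul (by norm_num) hx0.ne']
    exact Real.log_le_log hsR hsx
  have hlogs0 : 0 ≤ Real.log s := Real.log_nonneg (by exact_mod_cast hs)
  have hlog13 : 0 ≤ Real.log 13 := Real.log_nonneg (by norm_num)
  have hn' : 2000 * (Real.log 13 + 13 * Real.log 2000) + 26000 * Real.log x ≤
      Real.log 2 / 16 * x := by
    refine (le_abs_self _).trans (hn.trans_eq ?_)
    rw [id, Real.norm_of_nonneg hx0.le]
  rw [← Real.log_le_log_iff (by positivity) (by positivity),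
    Real.log_mul (by positivity) (by positivity), Real.log_pow, Real.log_pow,
    Real.log_mul (by norm_num) (by positivity), Real.log_pow, Real.log_rpow (by norm_num)]
  push_cast
  calc (s : ℝ) * (Real.log 13 + 12 * Real.log s) + s * Real.log s
      = s * (Real.log 13 + 13 * Real.log s) := by ring
    _ ≤ (2000 * x) * (Real.log 13 + 13 * Real.log s) := by gcongr
    _ ≤ (2000 * x) * (Real.log 13 + 13 * (Real.log 2000 + Real.log x)) := by gcongr
    _ = x * (2000 * (Real.log 13 + 13 * Real.log 2000) + 26000 * Real.log x) := by ring
    _ ≤ x * (Real.log 2 / 16 * x) := by gcongr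
    _ = n / 16 * Real.log 2 := by rw [← hxx]; ring

/-- Both sides equal `2 ^ 17` at `K = 32`, which ties the constant `17/32` to the threshold 32.
Growth beyond it follows from `1 + t ≤ exp t`, applied with `t = 0` at `K = 32`. -/
theorem four_mul_pow_three_le_two_rpow (K : ℝ) (hK : 32 ≤ K) :
    4 * K ^ 3 ≤ 2 ^ (17 * K / 32) := by
  have h1 : K / 32 ≤ 2 ^ (K / 16 - 2) := by
    rw [Real.rpow_def_of_pos two_pos]
    have h2 := Real.add_one_le_exp (Real.log 2 * (K / 16 - 2))
    have h3 : (0.6931471803 : ℝ) < Real.log 2 := Real.log_two_gt_d9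
    nlinarith
  have h2 : K ≤ 2 ^ (K / 16 + 3) := by
    rw [show K / 16 + 3 = (K / 16 - 2) + (5 : ℕ) by push_cast; ring,
      Real.rpow_add two_pos, Real.rpow_natCast]
    linarith
  calc 4 * K ^ 3 ≤ 2 ^ (2 : ℝ) * (2 ^ (K / 16 + 3)) ^ 3 := by
        gcongr
        norm_num
    _ = 2 ^ (3 * K / 16 + 11) := by
        rw [← Real.rpow_mul_natCast two_pos.le, ← Real.rpow_add two_pos]
        congr 1
        push_cast
        ring
    _ ≤ 2 ^ (17 * K / 32) := by
        apply Real.rpow_le_rpow_of_exponent_le one_le_two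
        linarith

/-- The binomial coefficient is at most `(eM/k) ^ k` with `M/k ≤ K³`, and `e ≤ 4`. -/
theorem choose_le_two_rpow (k m : ℕ) (hk : 0 < k) (hm : 32 * k ≤ m) :
    ((m ^ 3 / k ^ 2).choose k : ℝ) ≤ 2 ^ (17 * (m : ℝ) / 32) := by
  have hkR : (0 : ℝ) < k := by exact_mod_cast hk
  have hmR : (32 : ℝ) * k ≤ m := by exact_mod_cast hm
  set K : ℝ := m / k with hK
  have hKk : K * k = m := div_mul_cancel₀ _ hkR.ne'
  have hK32 : 32 ≤ K := (le_div_iff₀ hkR).2 hmR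
  have hM : ((m ^ 3 / k ^ 2 : ℕ) : ℝ) ≤ K ^ 3 * k := by
    refine Nat.cast_div_le.trans_eq ?_
    push_cast
    rw [← hKk]
    field_simp
  calc ((m ^ 3 / k ^ 2).choose k : ℝ) ≤ ((m ^ 3 / k ^ 2 : ℕ) : ℝ) ^ k / (k.factorial : ℝ) :=
        Nat.choose_le_pow_div k _
    _ ≤ (K ^ 3 * k) ^ k / (k.factorial : ℝ) := by gcongr
    _ = (K ^ 3) ^ k * ((k : ℝ) ^ k / (k.factorial : ℝ)) := by rw [mul_pow, mul_div_assoc]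
    _ ≤ (K ^ 3) ^ k * Real.exp k := by
        gcongr
        exact Real.pow_div_factorial_le_exp _ hkR.le k
    _ = (Real.exp 1 * K ^ 3) ^ k := by
        rw [mul_pow, ← Real.exp_nat_mul, mul_one, mul_comm]
    _ ≤ (4 * K ^ 3) ^ k := by
        gcongr
        have := Real.exp_one_lt_d9
        linarith
    _ ≤ (2 ^ (17 * K / 32)) ^ k := by
        gcongr
        exact four_mul_pow_three_le_two_rpow K hK32
    _ = 2 ^ (17 * (m : ℝ) / 32) := by
        rw [← Real.rpow_mul_natCast two_pos.le, ← hKk]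
        congr 1
        ring

theorem pow_le_two_rpow_of_le {N x : ℝ} (hN0 : 0 ≤ N) (hN : N ≤ 2 ^ x) (r : ℕ) :
    N ^ r ≤ 2 ^ (x * r) := by
  rw [Real.rpow_mul_natCast two_pos.le]
  gcongr

theorem half_pow_eq (n : ℕ) : (1 / 2 : ℝ) ^ n = 2 ^ (-(n : ℝ)) := by
  rw [Real.rpow_neg two_pos.le, Real.rpow_natCast, one_div, inv_pow]

/-- Exponents in units of `k`: `1/16` for the code, `64/160` for `N ^ 64`, `-3/4` for the
probability. The sum is below `-1/4`. -/
theorem small_doubling_term_le {k : ℕ} (hk : 1 ≤ Nat.sqrt k) {N : ℝ} (hN0 : 0 ≤ N)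
    (hN : N ≤ 2 ^ ((k : ℝ) / 160))
    (hcode : ∀ s : ℕ, 0 < s → s ≤ 2000 * Nat.sqrt k →
      ((13 * (s : ℝ) ^ 12) ^ s * (s : ℝ) ^ s) ≤ 2 ^ ((k : ℝ) / 16)) :
    (13 * (2000 * Nat.sqrt k : ℝ) ^ 12) ^ (2000 * Nat.sqrt k) *
      ((2000 * Nat.sqrt k) * N) ^ 64 * (1 / 2 : ℝ) ^ (k - k / 4) ≤ 2 ^ (-(k : ℝ) / 4) := by
  have h1 := hcode (2000 * Nat.sqrt k) (by omega) le_rfl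
  push_cast at h1
  have hs1 : (1 : ℝ) ≤ 2000 * Nat.sqrt k := by
    have : (1 : ℝ) ≤ Nat.sqrt k := by exact_mod_cast hk
    linarith
  have h2 : (2000 * Nat.sqrt k : ℝ) ^ 64 ≤ (2000 * Nat.sqrt k) ^ (2000 * Nat.sqrt k) :=
    pow_le_pow_right₀ hs1 (by omega)
  have h3 := pow_le_two_rpow_of_le hN0 hN 64
  have h4 : (1 / 2 : ℝ) ^ (k - k / 4) ≤ 2 ^ (-(3 * (k : ℝ) / 4)) := by
    rw [half_pow_eq]
    apply Real.rpow_le_rpow_of_exponent_le one_le_two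
    have : 3 * k ≤ 4 * (k - k / 4) := by omega
    have : (3 : ℝ) * k ≤ 4 * ((k - k / 4 : ℕ) : ℝ) := by exact_mod_cast this
    linarith
  calc _ = ((13 * (2000 * Nat.sqrt k : ℝ) ^ 12) ^ (2000 * Nat.sqrt k) *
        (2000 * Nat.sqrt k) ^ 64) * N ^ 64 * (1 / 2 : ℝ) ^ (k - k / 4) := by
        rw [mul_pow (2000 * (Nat.sqrt k : ℝ)) N]; ring
    _ ≤ ((13 * (2000 * Nat.sqrt k : ℝ) ^ 12) ^ (2000 * Nat.sqrt k) *
        (2000 * Nat.sqrt k) ^ (2000 * Nat.sqrt k)) * N ^ 64 * (1 / 2 : ℝ) ^ (k - k / 4) := by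
        gcongr
    _ ≤ 2 ^ ((k : ℝ) / 16) * 2 ^ ((k : ℝ) / 160 * (64 : ℕ)) * 2 ^ (-(3 * (k : ℝ) / 4)) := by
        gcongr
    _ = 2 ^ ((k : ℝ) / 16 + (k : ℝ) / 160 * (64 : ℕ) + -(3 * (k : ℝ) / 4)) := by
        rw [Real.rpow_add two_pos, Real.rpow_add two_pos]
    _ ≤ _ := by
        apply Real.rpow_le_rpow_of_exponent_le one_le_two
        push_cast
        have : (0 : ℝ) ≤ k := Nat.cast_nonneg k
        linarith

/-- Exponents in units of `m`: `1/16 + 1/80 + 17/32` for the count, at most `-31/32` for the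
probability since `k ≤ m/32`. The sum is below `-1/4`, and `m/4 ≥ 8k`. -/
theorem large_doubling_term_le {k m : ℕ} (hk : 0 < k) (hm : 32 * k ≤ m) (hmk : m ≤ k * k)
    {N : ℝ} (hN0 : 0 ≤ N) (hN : N ≤ 2 ^ ((k : ℝ) / 160))
    (hcode : ∀ s : ℕ, 0 < s → s ≤ 2000 * Nat.sqrt m →
      ((13 * (s : ℝ) ^ 12) ^ s * (s : ℝ) ^ s) ≤ 2 ^ ((m : ℝ) / 16)) :
    (13 * (2 * Nat.sqrt m + 2 : ℝ) ^ 12) ^ (2 * Nat.sqrt m + 2) *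
        ((2 * Nat.sqrt m + 2) * N) ^ (2 * m / k) * (m ^ 3 / k ^ 2).choose k *
          (1 / 2 : ℝ) ^ (m - k) ≤ (1 / 2) ^ (8 * k) := by
  have hm0 : 1 ≤ Nat.sqrt m := Nat.le_sqrt'.2 (by omega)
  have h1 := hcode (2 * Nat.sqrt m + 2) (by omega) (by omega)
  push_cast at h1
  have hsk : Nat.sqrt m ≤ k := (Nat.sqrt_le_sqrt hmk).trans (Nat.sqrt_eq k).le
  -- As `m ≤ k * k`, the rank bound `2m/k` is at most about `2√m`, so the power of the family length
  -- fits into `s ^ s`.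
  have hr : 2 * m / k ≤ 2 * Nat.sqrt m + 2 := by
    have h5 := Nat.sqrt_le_add m
    have h6 : 2 * m ≤ (2 * Nat.sqrt m + 4) * Nat.sqrt m := by linarith
    have h7 : m < (Nat.sqrt m + 1) * (Nat.sqrt m + 1) := Nat.lt_succ_sqrt m
    rcases hsk.eq_or_lt with h | h
    · have : m = k * k := le_antisymm hmk (by rw [← h]; exact Nat.sqrt_le m)
      rw [this, ← mul_assoc, Nat.mul_div_cancel _ hk, ← this, h]
      omega
    · apply Nat.div_le_of_le_mul
      nlinarith
  have h2 : (2 * Nat.sqrt m + 2 : ℝ) ^ (2 * m / k) ≤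
      (2 * Nat.sqrt m + 2) ^ (2 * Nat.sqrt m + 2) :=
    pow_le_pow_right₀ (by have : (0 : ℝ) ≤ Nat.sqrt m := Nat.cast_nonneg _
                          linarith) hr
  have h3 : N ^ (2 * m / k) ≤ 2 ^ ((m : ℝ) / 80) := by
    refine (pow_le_two_rpow_of_le hN0 hN _).trans ?_
    apply Real.rpow_le_rpow_of_exponent_le one_le_two
    have : ((k * (2 * m / k) : ℕ) : ℝ) ≤ (2 * m : ℕ) := Nat.cast_le.2 (Nat.mul_div_le _ _)
    push_cast at this
    linarith
  have h4 := choose_le_two_rpow k m hk hm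
  calc _ = ((13 * (2 * Nat.sqrt m + 2 : ℝ) ^ 12) ^ (2 * Nat.sqrt m + 2) *
        (2 * Nat.sqrt m + 2) ^ (2 * m / k)) * N ^ (2 * m / k) * (m ^ 3 / k ^ 2).choose k *
          (1 / 2 : ℝ) ^ (m - k) := by
        rw [mul_pow (2 * (Nat.sqrt m : ℝ) + 2) N]; ring
    _ ≤ ((13 * (2 * Nat.sqrt m + 2 : ℝ) ^ 12) ^ (2 * Nat.sqrt m + 2) *
        (2 * Nat.sqrt m + 2) ^ (2 * Nat.sqrt m + 2)) * N ^ (2 * m / k) *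
          (m ^ 3 / k ^ 2).choose k * (1 / 2 : ℝ) ^ (m - k) := by
        gcongr
    _ ≤ 2 ^ ((m : ℝ) / 16) * 2 ^ ((m : ℝ) / 80) * 2 ^ (17 * (m : ℝ) / 32) *
          (1 / 2 : ℝ) ^ (m - k) := by
        gcongr
    _ = 2 ^ ((m : ℝ) / 16 + (m : ℝ) / 80 + 17 * (m : ℝ) / 32 + -((m - k : ℕ) : ℝ)) := by
        rw [half_pow_eq, Real.rpow_add two_pos, Real.rpow_add two_pos, Real.rpow_add two_pos]
    _ ≤ _ := by
        rw [half_pow_eq]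
        apply Real.rpow_le_rpow_of_exponent_le one_le_two
        rw [Nat.cast_sub (by omega)]
        have : (32 : ℝ) * k ≤ m := by exact_mod_cast hm
        push_cast
        linarith

/-- For large `k` and `N ≤ 2 ^ (k / 160)`, it is unlikely that a random subset of `ℤ/Nℤ` contains
all sums of distinct elements of some `k`-element set. -/
theorem eventually_card_subtype_distinctSums_div_le : ∀ᶠ k : ℕ in atTop, ∀ (N : ℕ) [NeZero N],
    (N : ℝ) ≤ 2 ^ ((k : ℝ) / 160) →
    (Nat.card {A : Set (ZMod N) // ∃ X : Finset (ZMod N), X.card = k ∧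
        (distinctSums X : Set (ZMod N)) ⊆ A} : ℝ) / Nat.card (Set (ZMod N)) ≤
      2 ^ (-(k : ℝ) / 4) + (k ^ 2 + 1) * ((1 / 2 : ℝ) ^ 8) ^ k := by
  obtain ⟨n₀, hn₀⟩ := eventually_atTop.1 eventually_code_le_two_rpow
  filter_upwards [eventually_ge_atTop n₀, eventually_ge_atTop (4096 ^ 2)] with k hkn hk N _ hN
  refine (card_subtype_distinctSums_div_le k hk).trans (add_le_add ?_ ?_)
  · exact small_doubling_term_le (Nat.le_sqrt'.2 (by omega)) (Nat.cast_nonneg N) hN (hn₀ k hkn)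
  · refine (Finset.sum_le_card_nsmul _ _ ((1 / 2 : ℝ) ^ (8 * k)) fun m hm => ?_).trans ?_
    · rw [Finset.mem_Icc] at hm
      exact large_doubling_term_le (by omega) hm.1 hm.2 (Nat.cast_nonneg N) hN
        (hn₀ m (by omega))
    · rw [nsmul_eq_mul, Nat.card_Icc, pow_mul]
      gcongr
      have : k * k + 1 - 32 * k ≤ k ^ 2 + 1 := by rw [sq]; exact Nat.sub_le _ _
      exact_mod_cast this

theorem tendsto_error_zero :
    Tendsto (fun k : ℕ => (2 : ℝ) ^ (-(k : ℝ) / 4) + ((k : ℝ) ^ 2 + 1) * ((1 / 2 : ℝ) ^ 8) ^ k)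
      atTop (𝓝 0) := by
  have h1 : Tendsto (fun k : ℕ => (2 : ℝ) ^ (-(k : ℝ) / 4)) atTop (𝓝 0) := by
    have h2 : ∀ k : ℕ, (2 : ℝ) ^ (-(k : ℝ) / 4) = ((2 : ℝ) ^ (-1 / 4 : ℝ)) ^ k := by
      intro k
      rw [← Real.rpow_mul_natCast two_pos.le]
      congr 1
      ring
    simp_rw [h2]
    refine tendsto_pow_atTop_nhds_zero_of_lt_one (by positivity) ?_
    exact Real.rpow_lt_one_of_one_lt_of_neg one_lt_two (by norm_num)
  have h3 := tendsto_pow_const_mul_const_pow_of_lt_one 2 (r := (1 / 2 : ℝ) ^ 8) (by norm_num)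
    (by norm_num)
  have h4 := tendsto_pow_atTop_nhds_zero_of_lt_one (r := (1 / 2 : ℝ) ^ 8) (by norm_num)
    (by norm_num)
  have h5 := h1.add (h3.add h4)
  simp only [add_zero] at h5
  refine h5.congr fun k => ?_
  rw [add_mul, one_mul]

/-! ### From cliques to sumsets, and the limit -/

theorem cayleySumProb_eq_one_sub {Γ : Type*} [AddCommGroup Γ] [Finite Γ]
    (E : SimpleGraph Γ → Prop) :
    cayleySumProb Γ E = 1 - cayleySumProb Γ (fun G => ¬ E G) := by
  classical
  have h : Nat.card {A : Set Γ // E (cayleySumGraph A)} +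
      Nat.card {A : Set Γ // ¬ E (cayleySumGraph A)} = Nat.card (Set Γ) := by
    rw [← Nat.card_sum]
    exact Nat.card_congr (Equiv.sumCompl fun A : Set Γ => E (cayleySumGraph A))
  have hpos : (0 : ℝ) < Nat.card (Set Γ) := by exact_mod_cast Nat.card_pos
  rw [cayleySumProb, cayleySumProb, eq_sub_iff_add_eq, ← add_div, div_eq_one_iff_eq hpos.ne']
  exact_mod_cast h

theorem cayleySumProb_mono {Γ : Type*} [AddCommGroup Γ] [Finite Γ]
    (E : SimpleGraph Γ → Prop) (F : Set Γ → Prop) (h : ∀ A, E (cayleySumGraph A) → F A) :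
    cayleySumProb Γ E ≤ (Nat.card {A : Set Γ // F A} : ℝ) / Nat.card (Set Γ) := by
  rw [cayleySumProb]
  gcongr
  exact Nat.card_le_card_of_injective (Subtype.map id h)
    (Subtype.map_injective h Function.injective_id)

theorem exists_distinctSums_subset_of_le_cliqueNum {Γ : Type*} [AddCommGroup Γ] [Finite Γ]
    [DecidableEq Γ] (A : Set Γ) (k : ℕ) (hk : k ≤ (cayleySumGraph A).cliqueNum) :
    ∃ X : Finset Γ, X.card = k ∧ (distinctSums X : Set Γ) ⊆ A := by
  obtain ⟨S, hS⟩ := (cayleySumGraph A).exists_isNClique_cliqueNum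
  obtain ⟨X, hXS, hX⟩ := Finset.exists_subset_card_eq (hk.trans_eq hS.card_eq.symm)
  refine ⟨X, hX, fun s hs => ?_⟩
  obtain ⟨⟨a, b⟩, hab, rfl⟩ := Finset.mem_image.1 (Finset.mem_coe.1 hs)
  obtain ⟨ha, hb, hne⟩ := Finset.mem_offDiag.1 hab
  exact (hS.isClique (hXS ha) (hXS hb) hne).2

theorem theorem7 :
    Tendsto
      (fun N : ℕ+ =>
        cayleySumProb (ZMod (N : ℕ))
          (fun G => (G.cliqueNum : ℝ) ≤ 160 * Real.logb 2 ((N : ℕ) : ℝ)))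
      atTop (𝓝 1) := by
  -- The least integer above `160 log₂ N`: a clique number violating the bound is at least `κ N`,
  -- while `N ≤ 2 ^ (κ N / 160)`.
  let κ : ℕ+ → ℕ := fun N => ⌊160 * Real.logb 2 ((N : ℕ) : ℝ)⌋₊ + 1
  have hκ : Tendsto κ atTop atTop := by
    refine (tendsto_add_atTop_nat 1).comp (tendsto_nat_floor_atTop.comp ?_)
    exact ((Real.tendsto_logb_atTop one_lt_two).comp (tendsto_natCast_atTop_atTop.comp
      tendsto_PNat_val_atTop_atTop)).const_mul_atTop (by norm_num)
  have hlim := (tendsto_error_zero.comp hκ).const_sub 1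
  rw [sub_zero] at hlim
  refine tendsto_of_tendsto_of_tendsto_of_le_of_le' hlim tendsto_const_nhds ?_ ?_
  · filter_upwards [hκ.eventually eventually_card_subtype_distinctSums_div_le] with N hN
    have hN1 : (1 : ℝ) ≤ ((N : ℕ) : ℝ) := by exact_mod_cast N.pos
    have hlog0 : 0 ≤ 160 * Real.logb 2 ((N : ℕ) : ℝ) := by
      have := Real.logb_nonneg one_lt_two hN1
      linarith
    have hNκ : ((N : ℕ) : ℝ) ≤ 2 ^ ((κ N : ℝ) / 160) := by
      rw [← Real.logb_le_iff_le_rpow one_lt_two (by linarith)]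
      have := Nat.lt_floor_add_one (160 * Real.logb 2 ((N : ℕ) : ℝ))
      simp only [κ]
      push_cast
      linarith
    rw [cayleySumProb_eq_one_sub]
    refine sub_le_sub_left ((cayleySumProb_mono _ _ fun A hA => ?_).trans (hN N hNκ)) 1
    refine exists_distinctSums_subset_of_le_cliqueNum A (κ N) ?_
    exact Nat.succ_le_of_lt ((Nat.floor_lt hlog0).2 (not_le.1 hA))
  · refine Eventually.of_forall fun N => ?_
    rw [cayleySumProb_eq_one_sub, sub_le_self_iff, cayleySumProb]
    positivity
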